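/- **Proposition 1 (Approximation with the PIRPNN).** Let $0\le a<b$ and $t_0\in\mathbb R$. Consider either of the following initial-value problems. (A) *ODE in canonical form:* $\frac{du}{dt}=f(t,u)$, $u(t_0)=z\in\mathbb R^m$, where $f$ is continuous on a set $D\subset\mathbb R\times\mathbb R^m$ and Lipschitz continuous in $u$ there, uniformly in $t$. (B) *Index-1 DAE in semiexplicit form:* $\frac{du}{dt}=f(t,u,v)$, $0=g(t,u,v)$, $u(t_0)=z\in\mathbb R^{p}$, $v(t_0)=y\in\mathbb R^{q}$, where $f$ is continuous on a set $D\subset\mathbb R\times\mathbb R^p\times\mathbb R^q$ and Lipschitz continuous in $(u,v)$ there, uniformly in $t$, $g$ takes values in $\mathbb R^q$ and is continuously differentiable near every point of $D$, and the Jacobian $\nabla_v g$ is nonsingular at every point of $D$ where $g=0$. A solution on $[t_0,t_{end}]$ is a differentiable $u$ (in case (B) a differentiable $u$ together with a continuous $v$) that satisfies the equations and initial conditions on $[t_0,t_{end}]$ and whose graph lies in $D$. 1. *Existence.* If $D$ contains all points with $t\ge t_0$ of some neighbourhood of $(t_0,z)$ (in case (B): of $(t_0,z,y)$, and $g(t_0,z,y)=0$),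 then there is a solution on $[t_0,t_{end}]$ for some $t_{end}>t_0$. 2. *Uniqueness and regularity.* For every $t_{end}>t_0$, a solution on $[t_0,t_{end}]$ is unique if it exists, and its component $u$ is continuously differentiable. 3. *Approximation.* Suppose that $t_{end}>t_0$ and that a solution exists on $[t_0,t_{end}]$. Write $x_i$ for its components (those of $u$, in case (B) those of $u$ and $v$) and $x_i^0$ for their initial values. For each $N$ let the shape parameters $\alpha_{ji}=\alpha^{(N)}_{ji}$, $j=1,\dots,N$, be drawn i.i.d. (over all $j$ and $i$) from the uniform distribution on $(a,b)$, let $t_j=t_0+(j-1)\frac{t_{end}-t_0}{N-1}$, and consider the networks $$\Psi_{Ni}(t)=x_i^0+(t-t_0)\sum_{j=1}^N w_{ji}\,e^{-\alpha_{ji}(t-t_j)^2}.$$ Then the output weights $w_{ji}$ can be chosen, for every $N$, as functions of the sampled shape parameters such that $\Psi_{Ni}$ converges to $x_i$ uniformly on $[t_0,t_{end}]$ as $N\to\infty$, for all $i$, with high probability: for all $\varepsilon,\delta>0$ there is $N_0$ such that for every $N\ge N_0$, with probability at least $1-\delta$, $|\Psi_{Ni}(t)-x_i(t)|<\varepsilon$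 for all $i$ and all $t\in[t_0,t_{end}]$; moreover, with probability one, $\Psi_{Ni}\to x_i$ uniformly on $[t_0,t_{end}]$ for all $i$. -/

import Mathlib

open MeasureTheory ProbabilityTheory Set Filter Topology

/-- The Gaussian radial basis function with input weight `w`, bias `b`, shape parameter `α`
and center `c`. -/
noncomputable def gaussianRBF (w b α c t : ℝ) : ℝ :=
  Real.exp (-α * (w * t + b - c) ^ 2)

/-- The `N` equispaced centers of `[t₀, T]`; the index `j` runs through `0, …, N - 1`. -/
noncomputable def rbfCenter (t₀ T : ℝ) (N : ℕ) (j : Fin N) : ℝ :=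
  t₀ + (j : ℝ) * ((T - t₀) / ((N : ℝ) - 1))

/-- One network with initial value `z`, shape parameters `α` and output weights `w`; the input
weights are one and the biases are zero. -/
noncomputable def pirpnn (t₀ T z : ℝ) {N : ℕ} (α w : Fin N → ℝ) (t : ℝ) : ℝ :=
  z + (t - t₀) * ∑ j, w j * gaussianRBF 1 0 (α j) (rbfCenter t₀ T N j) t

/-- The random variables `X k` are independent, each uniformly distributed on `(a, b)`. -/
def IsIIDUniform {Ω κ : Type*} [MeasurableSpace Ω] (P : Measure Ω) (a b : ℝ)
    (X : κ → Ω → ℝ) : Prop :=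
  (∀ k, Measurable (X k)) ∧ iIndepFun X P ∧ ∀ k, pdf.IsUniform (X k) (Ioo a b) P volume

/-- The networks (one for each component `i`) with the random shape parameters
`α N i j`, `j < N`, converge uniformly on `[t₀, T]` to `u`: the output weights `W N` can be chosen
as functions of the sampled shape parameters such that all uniform errors are below `ε`, except
on an event of probability at most `δ`, for all large `N`; and such that the networks converge
uniformly with probability one. -/
def PIRPNNConverges {Ω ι : Type*} [MeasurableSpace Ω] (P : Measure Ω)
    (α : (N : ℕ) → ι → Fin N → Ω → ℝ) (t₀ T : ℝ) (z : ι → ℝ) (u : ℝ → ι → ℝ) : Prop :=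
  ∃ W : (N : ℕ) → (ι → Fin N → ℝ) → ι → Fin N → ℝ,
    (∀ ε > (0 : ℝ), ∀ δ > (0 : ℝ), ∃ N₀ : ℕ, ∀ N ≥ N₀,
      P {ω | ∃ i, ∃ t ∈ Icc t₀ T,
        ε ≤ |pirpnn t₀ T (z i) (fun j => α N i j ω) (W N (fun i j => α N i j ω) i) t - u t i|}
        ≤ ENNReal.ofReal δ) ∧
    (∀ᵐ ω ∂P, ∀ i, TendstoUniformlyOn
      (fun N t => pirpnn t₀ T (z i) (fun j => α N i j ω) (W N (fun i j => α N i j ω) i) t)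
      (fun t => u t i) atTop (Icc t₀ T))

/-- `u` solves `u' = f(t, u)`, `u(t₀) = z` on `[t₀, T]`, with its graph in `D`. -/
def IsODESolution {m : ℕ} (f : ℝ → (Fin m → ℝ) → (Fin m → ℝ)) (D : Set (ℝ × (Fin m → ℝ)))
    (t₀ T : ℝ) (z : Fin m → ℝ) (u : ℝ → Fin m → ℝ) : Prop :=
  u t₀ = z ∧ ∀ t ∈ Icc t₀ T,
    (t, u t) ∈ D ∧ HasDerivWithinAt u (f t (u t)) (Icc t₀ T) t

/-- `(u, v)` solves the semiexplicit system `u' = f(t, u, v)`, `0 = g(t, u, v)` on `[t₀, T]`,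
with `u(t₀) = z`, `v(t₀) = y`, with `v` continuous and with the graph of `(u, v)` in `D`. -/
def IsDAESolution {p q : ℕ} (f : ℝ → (Fin p → ℝ) → (Fin q → ℝ) → (Fin p → ℝ))
    (g : ℝ → (Fin p → ℝ) → (Fin q → ℝ) → (Fin q → ℝ))
    (D : Set (ℝ × (Fin p → ℝ) × (Fin q → ℝ))) (t₀ T : ℝ) (z : Fin p → ℝ) (y : Fin q → ℝ)
    (u : ℝ → Fin p → ℝ) (v : ℝ → Fin q → ℝ) : Prop :=
  u t₀ = z ∧ v t₀ = y ∧ ContinuousOn v (Icc t₀ T) ∧ ∀ t ∈ Icc t₀ T,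
    (t, u t, v t) ∈ D ∧ HasDerivWithinAt u (f t (u t) (v t)) (Icc t₀ T) t ∧
      g t (u t) (v t) = 0

/-!
For the differential equation everything is Picard–Lindelöf and Grönwall. At a point of an index-1
system the constraint can be solved for the algebraic variable, `v = φ(t, u)` with `φ` locally
Lipschitz, and every solution stays on this branch for a short time. This gives existence, and it
shows that the set on which two solutions agree, which is closed, is also open to the right.

For the approximation, fix a shape parameter `α ≠ 0` in `(a, b)`. A closed subspace of
`C([t₀, T])` that contains `exp (-α (t - c) ^ 2)` for all `c` in an open set also contains the
derivatives with respect to `c`, hence a fixed Gaussian times every polynomial, and by Weierstrass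
it is everything. So the functions `(t - t₀) exp (-α (t - c) ^ 2)` span a dense subspace of the
functions that vanish at `t₀`. A finite combination of them tolerates a small change of the pairs
`(α, c)`; and since a positive fraction of the `N` centers is near a given `c`, the probability
that no sample comes close to a given pair decays exponentially in `N`. The Borel–Cantelli lemma
turns this into almost sure convergence.
-/

theorem prodMk_mem_of_mem_nhdsWithin_prod {X Y : Type*} [TopologicalSpace X] [TopologicalSpace Y]
    {A : Set X} {D : Set (X × Y)} {x : X} {y : Y} (hx : x ∈ A) (hD : D ∈ 𝓝[A] x ×ˢ 𝓝 y) :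
    (x, y) ∈ D :=
  mem_of_mem_nhdsWithin (s := A ×ˢ univ) ⟨hx, mem_univ y⟩
    (by rwa [nhdsWithin_prod_eq, nhdsWithin_univ])

section InitialValueProblem

variable {E : Type*} [NormedAddCommGroup E] {f : ℝ → E → E} {D : Set (ℝ × E)} {K : NNReal}
  {t₀ T : ℝ} {z : E} {u u' : ℝ → E}

theorem exists_isPicardLindelof_of_mem_nhdsGE_prod
    (hc : ContinuousOn (fun x : ℝ × E => f x.1 x.2) D)
    (hl : ∀ t, LipschitzOnWith K (f t) {x | (t, x) ∈ D}) (hD : D ∈ 𝓝[≥] t₀ ×ˢ 𝓝 z) :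
    ∃ (T : ℝ) (hT : t₀ < T) (a L : NNReal),
      IsPicardLindelof f (⟨t₀, le_rfl, hT.le⟩ : Icc t₀ T) z a 0 L K := by
  have hmem : (t₀, z) ∈ D := prodMk_mem_of_mem_nhdsWithin_prod self_mem_Ici hD
  rw [← nhdsWithin_univ z, ← nhdsWithin_prod_eq] at hD
  set L : NNReal := ‖f t₀ z‖₊ + 1 with hL
  have hL0 : 0 < L := by positivity
  have hbound : ∀ᶠ x in 𝓝[Ici t₀ ×ˢ univ] (t₀, z), x ∈ D ∧ ‖f x.1 x.2‖ ≤ L := by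
    refine Filter.Eventually.and hD ?_
    refine (((hc _ hmem).mono_of_mem_nhdsWithin hD).norm.eventually_lt_const ?_).mono
      fun _ => le_of_lt
    simp [hL]
  rw [nhdsWithin_prod_eq, nhdsWithin_univ] at hbound
  obtain ⟨⟨r, a⟩, ⟨hr, ha⟩, hbox⟩ :=
    (nhdsGE_basis_Icc.prod Metric.nhds_basis_closedBall).eventually_iff.1 hbound
  lift a to NNReal using ha.le
  have hsub : Icc t₀ (min r (t₀ + a / L)) ⊆ Icc t₀ r := Icc_subset_Icc_right (min_le_left _ _)
  refine ⟨min r (t₀ + a / L), lt_min hr (lt_add_of_pos_right t₀ (by positivity)), a, L,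
    fun t ht => (hl t).mono fun x hx => (hbox (mk_mem_prod (hsub ht) hx)).1,
    fun x hx => ?_, fun t ht x hx => (hbox (mk_mem_prod (hsub ht) hx)).2, ?_⟩
  · exact hc.comp (f := fun t => (t, x)) (by fun_prop) fun t ht =>
      (hbox (mk_mem_prod (hsub ht) hx)).1
  · have hlength : min r (t₀ + a / L) - t₀ ≤ a / L := by linarith [min_le_right r (t₀ + a / L)]
    simp only [sub_self, NNReal.coe_zero, sub_zero]
    exact (mul_le_mul_of_nonneg_left (max_le hlength (by positivity)) L.2).trans_eq
      (mul_div_cancel₀ _ (NNReal.coe_pos.2 hL0).ne')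

variable [NormedSpace ℝ E]

/-- `u` solves the initial-value problem `u' = f(t, u)`, `u(t₀) = z` on `[t₀, T]`, with its graph
in `D`. The derivatives at the endpoints are one-sided. -/
structure IsIVPSolution (f : ℝ → E → E) (D : Set (ℝ × E)) (t₀ T : ℝ) (z : E) (u : ℝ → E) :
    Prop where
  initial : u t₀ = z
  mem : ∀ t ∈ Icc t₀ T, (t, u t) ∈ D
  hasDerivWithinAt : ∀ t ∈ Icc t₀ T, HasDerivWithinAt u (f t (u t)) (Icc t₀ T) t

theorem isODESolution_iff_isIVPSolution {m : ℕ} {f : ℝ → (Fin m → ℝ) → (Fin m → ℝ)}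
    {D : Set (ℝ × (Fin m → ℝ))} {z : Fin m → ℝ} {u : ℝ → Fin m → ℝ} :
    IsODESolution f D t₀ T z u ↔ IsIVPSolution f D t₀ T z u :=
  ⟨fun h => ⟨h.1, fun t ht => (h.2 t ht).1, fun t ht => (h.2 t ht).2⟩,
    fun h => ⟨h.initial, fun t ht => ⟨h.mem t ht, h.hasDerivWithinAt t ht⟩⟩⟩

namespace IsIVPSolution

theorem continuousOn (h : IsIVPSolution f D t₀ T z u) : ContinuousOn u (Icc t₀ T) :=
  fun t ht => (h.hasDerivWithinAt t ht).continuousWithinAt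

theorem continuousOn_graph (h : IsIVPSolution f D t₀ T z u) :
    ContinuousOn (fun t => (t, u t)) (Icc t₀ T) :=
  continuousOn_id.prodMk h.continuousOn

theorem hasDerivWithinAt_Ici (h : IsIVPSolution f D t₀ T z u) {t : ℝ} (ht : t ∈ Ico t₀ T) :
    HasDerivWithinAt u (f t (u t)) (Ici t) t :=
  (h.hasDerivWithinAt t (Ico_subset_Icc_self ht)).mono_of_mem_nhdsWithin
    (Icc_mem_nhdsGE_of_mem ht)

theorem eqOn (hl : ∀ t, LipschitzOnWith K (f t) {x | (t, x) ∈ D})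
    (h : IsIVPSolution f D t₀ T z u) (h' : IsIVPSolution f D t₀ T z u') :
    EqOn u u' (Icc t₀ T) :=
  ODE_solution_unique_of_mem_Icc_right (v := f) (s := fun t => {x | (t, x) ∈ D})
    (fun t _ => hl t) h.continuousOn (fun _ ht => h.hasDerivWithinAt_Ici ht)
    (fun t ht => h.mem t (Ico_subset_Icc_self ht)) h'.continuousOn
    (fun _ ht => h'.hasDerivWithinAt_Ici ht) (fun t ht => h'.mem t (Ico_subset_Icc_self ht))
    (h.initial.trans h'.initial.symm)

theorem contDiffOn (hT : t₀ < T) (hf : ContinuousOn (fun t => f t (u t)) (Icc t₀ T))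
    (h : IsIVPSolution f D t₀ T z u) : ContDiffOn ℝ 1 u (Icc t₀ T) := by
  have hunique := uniqueDiffOn_Icc hT
  refine (contDiffOn_one_iff_derivWithin hunique).2
    ⟨fun t ht => (h.hasDerivWithinAt t ht).differentiableWithinAt, hf.congr fun t ht => ?_⟩
  exact (h.hasDerivWithinAt t ht).derivWithin (hunique t ht)

end IsIVPSolution

theorem exists_isIVPSolution [CompleteSpace E]
    (hc : ContinuousOn (fun x : ℝ × E => f x.1 x.2) D)
    (hl : ∀ t, LipschitzOnWith K (f t) {x | (t, x) ∈ D}) (hD : D ∈ 𝓝[≥] t₀ ×ˢ 𝓝 z) :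
    ∃ T > t₀, ∃ u, IsIVPSolution f D t₀ T z u := by
  obtain ⟨T, hT, a, L, hf⟩ := exists_isPicardLindelof_of_mem_nhdsGE_prod hc hl hD
  obtain ⟨u, hu0 : u t₀ = z, hu⟩ := hf.exists_eq_forall_mem_Icc_hasDerivWithinAt₀
  have hgraph : Tendsto (fun t => (t, u t)) (𝓝[≥] t₀) (𝓝[≥] t₀ ×ˢ 𝓝 z) := by
    have hu_cont := (hu t₀ ⟨le_rfl, hT.le⟩).continuousWithinAt.mono_of_mem_nhdsWithin
      (Icc_mem_nhdsGE hT)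
    exact tendsto_id.prodMk (hu0 ▸ hu_cont)
  obtain ⟨r, hr, hsub⟩ := mem_nhdsGE_iff_exists_Icc_subset.1
    (inter_mem (hgraph.eventually hD) (Icc_mem_nhdsGE hT))
  exact ⟨r, hr, u, hu0, fun t ht => (hsub ht).1,
    fun t ht => (hu t (hsub ht).2).mono fun s hs => (hsub hs).2⟩

end InitialValueProblem

section ImplicitFunction

variable {X F G : Type*} [NormedAddCommGroup X] [NormedSpace ℝ X] [CompleteSpace X]
  [NormedAddCommGroup F] [NormedSpace ℝ F] [CompleteSpace F] [NormedAddCommGroup G]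
  [NormedSpace ℝ G] [CompleteSpace G]

theorem exists_lipschitzOnWith_implicit_of_contDiffAt {H : X × F → G} {x : X} {w : F}
    (hH : ContDiffAt ℝ 1 H (x, w)) (hinv : (fderiv ℝ (fun v => H (x, v)) w).IsInvertible) :
    ∃ φ : X → F, ∃ L : NNReal, ∃ U ∈ 𝓝 x, LipschitzOnWith L φ U ∧ φ x = w ∧
      (∀ s ∈ U, H (s, φ s) = H (x, w)) ∧ ∀ᶠ s in 𝓝 (x, w), H s = H (x, w) → φ s.1 = s.2 := by
  have hpartial : HasFDerivAt (fun v => H (x, v)) (fderiv ℝ H (x, w) ∘L .inr ℝ X F) w :=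
    (hH.differentiableAt one_ne_zero).hasFDerivAt.comp w (hasFDerivAt_prodMk_right x w)
  rw [hpartial.fderiv] at hinv
  obtain ⟨L, U, hU, hL⟩ :=
    (hH.contDiffAt_implicitFunction one_ne_zero hinv).exists_lipschitzOnWith
  exact ⟨hH.implicitFunction one_ne_zero hinv, L, U ∩ {s | H (s, _) = H (x, w)},
    inter_mem hU (hH.eventually_apply_implicitFunction one_ne_zero hinv),
    hL.mono inter_subset_left, hH.implicitFunction_apply_self one_ne_zero hinv,
    fun s hs => hs.2,
    (hH.eventually_apply_eq_iff_implicitFunction one_ne_zero hinv).mono fun s hs => hs.1⟩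

end ImplicitFunction

section SemiexplicitDAE

variable {E F G : Type*} [NormedAddCommGroup E] [NormedAddCommGroup F] [NormedAddCommGroup G]
  {f : ℝ → E → F → E} {g : ℝ → E → F → G} {D : Set (ℝ × E × F)}
  {φ : ℝ × E → F} {U : Set (ℝ × E)} {K L : NNReal} {t₀ T s r : ℝ} {z : E} {y : F}
  {u u' : ℝ → E} {v v' : ℝ → F}

/-- The right-hand side of the underlying ODE `u' = f(t, u, φ(t, u))`, obtained by solving the
constraint for the algebraic variable, `v = φ(t, u)`. -/
def reducedField (f : ℝ → E → F → E) (φ : ℝ × E → F) (t : ℝ) (x : E) : E :=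
  f t x (φ (t, x))

/-- The part of `U` over which the graph of `φ` lies in `D`: the domain of the underlying ODE if
`φ` solves the constraint on `U`. -/
def reducedDomain (D : Set (ℝ × E × F)) (φ : ℝ × E → F) (U : Set (ℝ × E)) : Set (ℝ × E) :=
  {x ∈ U | (x.1, x.2, φ x) ∈ D}

theorem continuousOn_reducedField (hc : ContinuousOn (fun x : ℝ × E × F => f x.1 x.2.1 x.2.2) D)
    (hφ : ContinuousOn φ U) :
    ContinuousOn (fun x : ℝ × E => reducedField f φ x.1 x.2) (reducedDomain D φ U) :=
  hc.comp (f := fun x : ℝ × E => (x.1, x.2, φ x))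
    (continuousOn_fst.prodMk (continuousOn_snd.prodMk (hφ.mono fun _ hx => hx.1)))
    fun _ hx => hx.2

theorem lipschitzOnWith_reducedField
    (hl : ∀ t, LipschitzOnWith K (fun x : E × F => f t x.1 x.2) {x | (t, x) ∈ D})
    (hφ : LipschitzOnWith L φ U) (t : ℝ) :
    LipschitzOnWith (K * max 1 L) (reducedField f φ t) {x | (t, x) ∈ reducedDomain D φ U} := by
  have hφt : LipschitzOnWith L (fun x => φ (t, x)) {x | (t, x) ∈ reducedDomain D φ U} := by
    simpa only [mul_one, Function.comp_def] using
      hφ.comp (LipschitzWith.prodMk_left t).lipschitzOnWith fun x hx => hx.1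
  exact (hl t).comp (f := fun x => (x, φ (t, x)))
    (LipschitzWith.id.lipschitzOnWith.prodMk hφt) fun x hx => hx.2

theorem reducedDomain_mem_nhdsGE_prod (hU : U ∈ 𝓝 (t₀, z)) (hφ : ContinuousAt φ (t₀, z))
    (hD : D ∈ 𝓝[≥] t₀ ×ˢ 𝓝 (z, φ (t₀, z))) : reducedDomain D φ U ∈ 𝓝[≥] t₀ ×ˢ 𝓝 z := by
  have hle : 𝓝[≥] t₀ ×ˢ 𝓝 z ≤ 𝓝 (t₀, z) :=
    (Filter.prod_mono_left _ nhdsWithin_le_nhds).trans_eq nhds_prod_eq.symm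
  have hgraph : Tendsto (fun x => (x.1, x.2, φ x)) (𝓝[≥] t₀ ×ˢ 𝓝 z)
      (𝓝[≥] t₀ ×ˢ 𝓝 (z, φ (t₀, z))) :=
    tendsto_fst.prodMk (tendsto_snd.prodMk_nhds (hφ.mono_left hle))
  exact inter_mem (hle hU) (hgraph.eventually hD)

variable [NormedSpace ℝ E]

/-- `(u, v)` solves the semiexplicit system `u' = f(t, u, v)`, `0 = g(t, u, v)` on `[t₀, T]` with
`u(t₀) = z`, `v(t₀) = y`; that is, `u` solves the initial-value problem which `v` turns the
differential equation into. -/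
structure IsSemiexplicitSolution (f : ℝ → E → F → E) (g : ℝ → E → F → G) (D : Set (ℝ × E × F))
    (t₀ T : ℝ) (z : E) (y : F) (u : ℝ → E) (v : ℝ → F) : Prop extends
    IsIVPSolution (fun t x => f t x (v t)) {x | (x.1, x.2, v x.1) ∈ D} t₀ T z u where
  initial_algebraic : v t₀ = y
  continuousOn_algebraic : ContinuousOn v (Icc t₀ T)
  constraint : ∀ t ∈ Icc t₀ T, g t (u t) (v t) = 0

theorem isDAESolution_iff_isSemiexplicitSolution {p q : ℕ}
    {f : ℝ → (Fin p → ℝ) → (Fin q → ℝ) → (Fin p → ℝ)}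
    {g : ℝ → (Fin p → ℝ) → (Fin q → ℝ) → (Fin q → ℝ)}
    {D : Set (ℝ × (Fin p → ℝ) × (Fin q → ℝ))} {z : Fin p → ℝ} {y : Fin q → ℝ}
    {u : ℝ → Fin p → ℝ} {v : ℝ → Fin q → ℝ} :
    IsDAESolution f g D t₀ T z y u v ↔ IsSemiexplicitSolution f g D t₀ T z y u v :=
  ⟨fun ⟨hu, hv, hcont, h⟩ => ⟨⟨hu, fun t ht => (h t ht).1, fun t ht => (h t ht).2.1⟩, hv, hcont,
      fun t ht => (h t ht).2.2⟩,
    fun h => ⟨h.initial, h.initial_algebraic, h.continuousOn_algebraic,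
      fun t ht => ⟨h.mem t ht, h.hasDerivWithinAt t ht, h.constraint t ht⟩⟩⟩

/-- The index-1 condition: `g` is continuously differentiable at every point of `D`, and its
partial derivative in the algebraic variable is invertible where `g = 0`. -/
structure IsIndexOne [NormedSpace ℝ F] [NormedSpace ℝ G] (g : ℝ → E → F → G)
    (D : Set (ℝ × E × F)) : Prop where
  contDiffAt : ∀ x ∈ D, ContDiffAt ℝ 1 (fun x : ℝ × E × F => g x.1 x.2.1 x.2.2) x
  isInvertible_fderiv : ∀ x ∈ D, g x.1 x.2.1 x.2.2 = 0 →
    (fderiv ℝ (g x.1 x.2.1) x.2.2).IsInvertible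

theorem isIndexOne_of_det_ne_zero [NormedSpace ℝ F] [FiniteDimensional ℝ F] {g : ℝ → E → F → F}
    (hg : ∀ x ∈ D, ContDiffAt ℝ 1 (fun x : ℝ × E × F => g x.1 x.2.1 x.2.2) x)
    (hdet : ∀ x ∈ D, g x.1 x.2.1 x.2.2 = 0 → (fderiv ℝ (g x.1 x.2.1) x.2.2).det ≠ 0) :
    IsIndexOne g D :=
  ⟨hg, fun x hx h0 => ⟨_, (fderiv ℝ (g x.1 x.2.1) x.2.2).coe_toContinuousLinearEquivOfDetNeZero
    (hdet x hx h0)⟩⟩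

theorem IsIndexOne.exists_lipschitzOnWith_implicit [CompleteSpace E] [NormedSpace ℝ F]
    [CompleteSpace F] [NormedSpace ℝ G] [CompleteSpace G] (hg : IsIndexOne g D)
    {t : ℝ} {x : E} {w : F} (hmem : (t, x, w) ∈ D) (h0 : g t x w = 0) :
    ∃ φ : ℝ × E → F, ∃ L : NNReal, ∃ U ∈ 𝓝 (t, x), LipschitzOnWith L φ U ∧ φ (t, x) = w ∧
      (∀ s ∈ U, g s.1 s.2 (φ s) = 0) ∧
      ∀ᶠ s : ℝ × E × F in 𝓝 (t, x, w), g s.1 s.2.1 s.2.2 = 0 → φ (s.1, s.2.1) = s.2.2 := by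
  have hH : ContDiffAt ℝ 1 (fun s : (ℝ × E) × F => g s.1.1 s.1.2 s.2) ((t, x), w) :=
    ContDiffAt.comp (g := fun s : ℝ × E × F => g s.1 s.2.1 s.2.2)
      (f := fun s : (ℝ × E) × F => (s.1.1, s.1.2, s.2)) _ (hg.contDiffAt _ hmem) (by fun_prop)
  obtain ⟨φ, L, U, hU, hL, hφ, hφ0, hunique⟩ := exists_lipschitzOnWith_implicit_of_contDiffAt hH
    (hg.isInvertible_fderiv _ hmem h0)
  have hassoc : Tendsto (fun s : ℝ × E × F => ((s.1, s.2.1), s.2.2)) (𝓝 (t, x, w))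
      (𝓝 ((t, x), w)) := Continuous.tendsto (by fun_prop) _
  simp only [h0] at hφ0 hunique
  exact ⟨φ, L, U, hU, hL, hφ, hφ0, hassoc.eventually hunique⟩

theorem exists_isSemiexplicitSolution [CompleteSpace E] [NormedSpace ℝ F] [CompleteSpace F]
    [NormedSpace ℝ G] [CompleteSpace G]
    (hc : ContinuousOn (fun x : ℝ × E × F => f x.1 x.2.1 x.2.2) D)
    (hl : ∀ t, LipschitzOnWith K (fun x : E × F => f t x.1 x.2) {x | (t, x) ∈ D})
    (hg : IsIndexOne g D) (hD : D ∈ 𝓝[≥] t₀ ×ˢ 𝓝 (z, y)) (h0 : g t₀ z y = 0) :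
    ∃ T > t₀, ∃ u v, IsSemiexplicitSolution f g D t₀ T z y u v := by
  have hmem : (t₀, z, y) ∈ D := prodMk_mem_of_mem_nhdsWithin_prod self_mem_Ici hD
  obtain ⟨φ, L, U, hU, hL, rfl, hφ0, -⟩ := hg.exists_lipschitzOnWith_implicit hmem h0
  obtain ⟨T, hT, u, hu⟩ := exists_isIVPSolution (continuousOn_reducedField hc hL.continuousOn)
    (lipschitzOnWith_reducedField hl hL)
    (reducedDomain_mem_nhdsGE_prod hU (hL.continuousOn.continuousAt hU) hD)
  exact ⟨T, hT, u, fun t => φ (t, u t),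
    ⟨hu.initial, fun t ht => (hu.mem t ht).2, hu.hasDerivWithinAt⟩, by simp only [hu.initial],
    hL.continuousOn.comp hu.continuousOn_graph fun t ht => (hu.mem t ht).1,
    fun t ht => hφ0 _ (hu.mem t ht).1⟩

namespace IsSemiexplicitSolution

theorem continuousOn_prodMk (h : IsSemiexplicitSolution f g D t₀ T z y u v) :
    ContinuousOn (fun t => (t, u t, v t)) (Icc t₀ T) :=
  continuousOn_id.prodMk (h.continuousOn.prodMk h.continuousOn_algebraic)

theorem contDiffOn_differential (hT : t₀ < T)
    (hc : ContinuousOn (fun x : ℝ × E × F => f x.1 x.2.1 x.2.2) D)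
    (h : IsSemiexplicitSolution f g D t₀ T z y u v) : ContDiffOn ℝ 1 u (Icc t₀ T) :=
  h.contDiffOn hT (hc.comp h.continuousOn_prodMk h.mem)

theorem eventually_mem_and_eq_implicit (h : IsSemiexplicitSolution f g D t₀ T z y u v)
    (hs : s ∈ Ico t₀ T) (hU : U ∈ 𝓝 (s, u s))
    (hφ : ∀ᶠ x : ℝ × E × F in 𝓝 (s, u s, v s), g x.1 x.2.1 x.2.2 = 0 → φ (x.1, x.2.1) = x.2.2) :
    ∀ᶠ t in 𝓝[≥] s, t ∈ Icc t₀ T ∧ (t, u t) ∈ U ∧ v t = φ (t, u t) := by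
  have hIcc : Icc t₀ T ∈ 𝓝[≥] s := Icc_mem_nhdsGE_of_mem hs
  have hsI := Ico_subset_Icc_self hs
  filter_upwards [hIcc,
    ((h.continuousOn_graph s hsI).mono_of_mem_nhdsWithin hIcc).eventually hU,
    ((h.continuousOn_prodMk s hsI).mono_of_mem_nhdsWithin hIcc).eventually hφ]
    with t ht htU htφ using ⟨ht, htU, (htφ (h.constraint t ht)).symm⟩

theorem isIVPSolution_reducedField (h : IsSemiexplicitSolution f g D t₀ T z y u v)
    (hφ : ∀ t ∈ Icc s r, t ∈ Icc t₀ T ∧ (t, u t) ∈ U ∧ v t = φ (t, u t)) :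
    IsIVPSolution (reducedField f φ) (reducedDomain D φ U) s r (u s) u where
  initial := rfl
  mem t ht := by
    obtain ⟨htI, htU, hv⟩ := hφ t ht
    exact ⟨htU, hv ▸ h.mem t htI⟩
  hasDerivWithinAt t ht := by
    obtain ⟨htI, -, hv⟩ := hφ t ht
    rw [reducedField, ← hv]
    exact (h.hasDerivWithinAt t htI).mono fun t' ht' => (hφ t' ht').1

variable [CompleteSpace E] [NormedSpace ℝ F] [CompleteSpace F] [NormedSpace ℝ G]
  [CompleteSpace G]

theorem eventually_eq_nhdsGT
    (hl : ∀ t, LipschitzOnWith K (fun x : E × F => f t x.1 x.2) {x | (t, x) ∈ D})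
    (hg : IsIndexOne g D) (h : IsSemiexplicitSolution f g D t₀ T z y u v)
    (h' : IsSemiexplicitSolution f g D t₀ T z y u' v') (hs : s ∈ Ico t₀ T) (hu : u s = u' s)
    (hv : v s = v' s) : ∀ᶠ t in 𝓝[>] s, u t = u' t ∧ v t = v' t := by
  have hsI := Ico_subset_Icc_self hs
  obtain ⟨φ, L, U, hU, hL, -, -, hφ⟩ :=
    hg.exists_lipschitzOnWith_implicit (h.mem s hsI) (h.constraint s hsI)
  obtain ⟨r, hr, hsub⟩ := mem_nhdsGE_iff_exists_Icc_subset.1 <|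
    (h.eventually_mem_and_eq_implicit hs hU hφ).and <|
      h'.eventually_mem_and_eq_implicit hs (hu ▸ hU) (hu ▸ hv ▸ hφ)
  have hred := h.isIVPSolution_reducedField fun t ht => (hsub ht).1
  have hred' := h'.isIVPSolution_reducedField fun t ht => (hsub ht).2
  filter_upwards [Icc_mem_nhdsGT hr] with t ht
  have hut : u t = u' t := hred.eqOn (lipschitzOnWith_reducedField hl hL) (hu ▸ hred') ht
  exact ⟨hut, by rw [(hsub ht).1.2.2, (hsub ht).2.2.2, hut]⟩

theorem eqOn_prodMk
    (hl : ∀ t, LipschitzOnWith K (fun x : E × F => f t x.1 x.2) {x | (t, x) ∈ D})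
    (hg : IsIndexOne g D) (h : IsSemiexplicitSolution f g D t₀ T z y u v)
    (h' : IsSemiexplicitSolution f g D t₀ T z y u' v') :
    EqOn (fun t => (u t, v t)) (fun t => (u' t, v' t)) (Icc t₀ T) := by
  have hclosed : IsClosed ({t | (u t, v t) = (u' t, v' t)} ∩ Icc t₀ T) := by
    rw [inter_comm]
    exact ((h.continuousOn.prodMk h.continuousOn_algebraic).prodMk
      (h'.continuousOn.prodMk h'.continuousOn_algebraic)).preimage_isClosed_of_isClosed
        isClosed_Icc isClosed_diagonal
  refine hclosed.Icc_subset_of_forall_mem_nhdsWithin ?_ fun s ⟨hs, hsI⟩ => ?_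
  · simp only [mem_ofPred_eq, h.initial, h'.initial, h.initial_algebraic, h'.initial_algebraic]
  · have hs' := Prod.mk.inj hs
    exact (h.eventually_eq_nhdsGT hl hg h' hsI hs'.1 hs'.2).mono fun t ht => Prod.ext ht.1 ht.2

end IsSemiexplicitSolution

end SemiexplicitDAE

section Density

theorem mem_of_hasDerivAt_of_eventually_mem {E : Type*} [NormedAddCommGroup E] [NormedSpace ℝ E]
    {V : Submodule ℝ E} (hV : IsClosed (V : Set E)) {h : ℝ → E} {h' : E} {c : ℝ}
    (hd : HasDerivAt h h' c) (hmem : ∀ᶠ s in 𝓝 c, h s ∈ V) : h' ∈ V := by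
  refine hV.mem_of_tendsto hd.tendsto_slope ?_
  filter_upwards [nhdsWithin_le_nhds hmem] with s hs
  exact V.smul_mem _ (V.sub_mem hs hmem.self_of_nhds)

theorem exp_smul_mul_pow_mem {A : Type*} [NormedRing A] [NormedAlgebra ℝ A] [CompleteSpace A]
    {V : Submodule ℝ A} (hV : IsClosed (V : Set A)) {I : Set ℝ} (hI : IsOpen I) {y : A}
    (hexp : ∀ c ∈ I, NormedSpace.exp (c • y) ∈ V) (n : ℕ) :
    ∀ c ∈ I, NormedSpace.exp (c • y) * y ^ n ∈ V := by
  induction n with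
  | zero => simpa only [pow_zero, mul_one] using hexp
  | succ n ih =>
    intro c hc
    have hderiv : HasDerivAt (fun s : ℝ => NormedSpace.exp (s • y) * y ^ n)
        (NormedSpace.exp (c • y) * y * y ^ n) c := (hasDerivAt_exp_smul_const y c).mul_const _
    rw [pow_succ', ← mul_assoc]
    exact mem_of_hasDerivAt_of_eventually_mem hV hderiv (eventually_of_mem (hI.mem_nhds hc) ih)

theorem eq_top_of_isUnit_mul_X_pow_mem {s : Set ℝ} [CompactSpace s] {V : Submodule ℝ C(s, ℝ)}
    (hV : IsClosed (V : Set C(s, ℝ))) {M : C(s, ℝ)} (hM : IsUnit M)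
    (hmem : ∀ n, M * (Polynomial.X.toContinuousMapOn s) ^ n ∈ V) : V = ⊤ := by
  let W : Submodule ℝ C(s, ℝ) := V.comap (LinearMap.mulLeft ℝ M)
  have hW : IsClosed (W : Set C(s, ℝ)) := hV.preimage (continuous_const_mul M)
  have hpoly : ∀ p : Polynomial ℝ, Polynomial.toContinuousMapOnAlgHom s p ∈ W := fun p => by
    induction p using Polynomial.induction_on' with
    | add p q hp hq => exact map_add (Polynomial.toContinuousMapOnAlgHom s) p q ▸ W.add_mem hp hq
    | monomial n a =>
      rw [← Polynomial.smul_X_eq_monomial, map_smul, map_pow]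
      exact W.smul_mem a (hmem n)
  have hpoly_le : (polynomialFunctions s : Set C(s, ℝ)) ⊆ W := by
    rw [polynomialFunctions_coe]
    exact range_subset_iff.2 hpoly
  have hW_top (φ : C(s, ℝ)) : φ ∈ W := by
    refine closure_minimal hpoly_le hW ?_
    have : φ ∈ (polynomialFunctions s).topologicalClosure := by
      rw [polynomialFunctions.topologicalClosure s]
      trivial
    exact this
  obtain ⟨M, rfl⟩ := hM
  exact V.eq_top_iff'.2 fun φ => by simpa [W] using hW_top (↑M⁻¹ * φ)

/-- The Gaussian with shape parameter `p.1` and center `p.2` as a continuous function on `s`. -/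
noncomputable def gaussianMap (s : Set ℝ) (p : ℝ × ℝ) : C(s, ℝ) where
  toFun t := gaussianRBF 1 0 p.1 p.2 t
  continuous_toFun := by unfold gaussianRBF; fun_prop

theorem continuous_gaussianMap (s : Set ℝ) : Continuous (gaussianMap s) := by
  refine ContinuousMap.continuous_of_continuous_uncurry _ ?_
  simp only [Function.uncurry_def, gaussianMap, ContinuousMap.coe_mk, gaussianRBF]
  fun_prop

theorem continuousMap_exp_apply {X : Type*} [TopologicalSpace X] [CompactSpace X] (f : C(X, ℝ))
    (x : X) : NormedSpace.exp f x = Real.exp (f x) := by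
  let _ : NormedAlgebra ℚ C(X, ℝ) := NormedAlgebra.restrictScalars ℚ ℝ C(X, ℝ)
  rw [Real.exp_eq_exp_ℝ]
  exact NormedSpace.map_exp (ContinuousMap.evalAlgHom ℝ ℝ x) (continuous_eval_const x) f

theorem eq_top_of_gaussianMap_mem {s : Set ℝ} [CompactSpace s] {V : Submodule ℝ C(s, ℝ)}
    (hV : IsClosed (V : Set C(s, ℝ))) {α : ℝ} (hα : α ≠ 0) {I : Set ℝ} (hI : IsOpen I)
    (hne : I.Nonempty) (hmem : ∀ c ∈ I, gaussianMap s (α, c) ∈ V) : V = ⊤ := by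
  set x : C(s, ℝ) := Polynomial.X.toContinuousMapOn s with hx
  set y : C(s, ℝ) := (2 * α) • x with hy
  set B : C(s, ℝ) := NormedSpace.exp ((-α) • x ^ 2) with hB
  -- `exp (-α (t - c) ^ 2) = exp (-α c ^ 2) * exp (-α t ^ 2) * exp (2 α c t)`
  have hexp (c : ℝ) (hc : c ∈ I) : B * NormedSpace.exp (c • y) ∈ V := by
    have hfactor :
        B * NormedSpace.exp (c • y) = Real.exp (α * c ^ 2) • gaussianMap s (α, c) := by
      ext t
      simp only [hB, hy, hx, ContinuousMap.mul_apply, ContinuousMap.smul_apply,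
        continuousMap_exp_apply, ContinuousMap.pow_apply, gaussianMap, gaussianRBF, smul_eq_mul,
        ContinuousMap.coe_mk, Polynomial.toContinuousMapOn_apply, Polynomial.eval_X,
        Polynomial.toContinuousMap_apply, ← Real.exp_add]
      ring_nf
    exact hfactor ▸ V.smul_mem _ (hmem c hc)
  obtain ⟨c, hc⟩ := hne
  have hunit : IsUnit (B * NormedSpace.exp (c • y)) := by
    let _ : NormedAlgebra ℚ C(s, ℝ) := NormedAlgebra.restrictScalars ℚ ℝ C(s, ℝ)
    exact (NormedSpace.isUnit_exp _).mul (NormedSpace.isUnit_exp _)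
  refine eq_top_of_isUnit_mul_X_pow_mem hV hunit fun n => ?_
  have hpow : B * (NormedSpace.exp (c • y) * y ^ n) ∈ V :=
    exp_smul_mul_pow_mem (V := V.comap (LinearMap.mulLeft ℝ B))
      (hV.preimage (continuous_const_mul B)) hI hexp n c hc
  have hxy : x ^ n = ((2 * α) ^ n)⁻¹ • y ^ n := by
    rw [hy, smul_pow, inv_smul_smul₀ (by positivity)]
  rw [← hx, hxy, mul_smul_comm, mul_assoc]
  exact V.smul_mem _ hpow

theorem mem_closure_span_singleton_of_forall_eq_zero {X 𝕜 : Type*} [RCLike 𝕜] [TopologicalSpace X]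
    [CompactSpace X] [T2Space X] {g h : C(X, 𝕜)} (hgh : ∀ x, g x = 0 → h x = 0) :
    h ∈ (Ideal.span {g}).closure := by
  rw [← ContinuousMap.idealOfSet_ofIdeal_eq_closure, ContinuousMap.mem_idealOfSet]
  exact fun x hx => hgh x (ContinuousMap.notMem_setOfIdeal.1 hx (Ideal.mem_span_singleton_self g))

/-- The function `(t - t₀) exp (-α (t - c) ^ 2)` on `[t₀, T]`, `p = (α, c)`: a network with initial
value zero is a linear combination of such functions. -/
noncomputable def trialFunction (t₀ T : ℝ) (p : ℝ × ℝ) : C(Icc t₀ T, ℝ) :=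
  ⟨fun t => (t : ℝ) - t₀, by fun_prop⟩ * gaussianMap (Icc t₀ T) p

theorem continuous_trialFunction (t₀ T : ℝ) : Continuous (trialFunction t₀ T) :=
  (continuous_gaussianMap _).const_mul _

theorem mem_topologicalClosure_span_trialFunction {t₀ T : ℝ} {h : C(Icc t₀ T, ℝ)}
    (h0 : ∀ t : Icc t₀ T, t.1 = t₀ → h t = 0) {α : ℝ} (hα : α ≠ 0) {I : Set ℝ} (hI : IsOpen I)
    (hne : I.Nonempty) :
    h ∈ (Submodule.span ℝ (trialFunction t₀ T '' ({α} ×ˢ I))).topologicalClosure := by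
  set V := (Submodule.span ℝ (trialFunction t₀ T '' ({α} ×ˢ I))).topologicalClosure
  have hV : IsClosed (V : Set C(Icc t₀ T, ℝ)) := Submodule.isClosed_topologicalClosure _
  set g : C(Icc t₀ T, ℝ) := ⟨fun t => (t : ℝ) - t₀, by fun_prop⟩
  have htop : V.comap (LinearMap.mulLeft ℝ g) = ⊤ :=
    eq_top_of_gaussianMap_mem (hV.preimage (continuous_const_mul g)) hα hI hne fun c hc =>
      Submodule.le_topologicalClosure _ (Submodule.subset_span ⟨(α, c), ⟨rfl, hc⟩, rfl⟩)
  have hideal : (Ideal.span {g} : Set C(Icc t₀ T, ℝ)) ⊆ V := fun k hk => by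
    obtain ⟨φ, rfl⟩ := Ideal.mem_span_singleton'.1 hk
    rw [mul_comm]
    exact htop.ge (Submodule.mem_top (x := φ))
  exact closure_minimal hideal hV
    (mem_closure_span_singleton_of_forall_eq_zero fun t ht => h0 t (sub_eq_zero.1 ht))

end Density

section TrialSpace

theorem exists_finset_forall_subset_thickening_infDist_lt {X E : Type*} [PseudoMetricSpace X]
    [NormedAddCommGroup E] [NormedSpace ℝ E] {G : X → E} (hG : Continuous G) {S : Set X} {ψ : E}
    (hψ : ψ ∈ (Submodule.span ℝ (G '' S)).topologicalClosure) {ε : ℝ} (hε : 0 < ε) :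
    ∃ s : Finset X, ↑s ⊆ S ∧ ∃ η > 0, ∀ A : Set X, ↑s ⊆ Metric.thickening η A →
      Metric.infDist ψ (Submodule.span ℝ (G '' A)) < ε := by
  obtain ⟨ψ', hψ', hdist⟩ := Metric.mem_closure_iff.1 hψ ε hε
  obtain ⟨s, hs, c, rfl⟩ := Submodule.mem_span_image_iff_exists_fun ℝ |>.1 hψ'
  have hopen : IsOpen {p : s → X | dist ψ (∑ i, c i • G (p i)) < ε} :=
    isOpen_lt (by fun_prop) continuous_const
  obtain ⟨η, hη, hball⟩ := Metric.isOpen_iff.1 hopen (fun i => i) hdist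
  refine ⟨s, hs, η, hη, fun A hA => ?_⟩
  choose p hpA hp using fun i : s => Metric.mem_thickening_iff.1 (hA i.2)
  refine (Metric.infDist_lt_iff (Submodule.nonempty _)).2 ⟨∑ i, c i • G (p i), ?_, hball ?_⟩
  · exact Submodule.sum_smul_mem _ _ fun i _ => Submodule.subset_span ⟨p i, hpA i, rfl⟩
  · exact (dist_pi_lt_iff hη).2 fun i => dist_comm (i : X) (p i) ▸ hp i

variable {t₀ T : ℝ} {N : ℕ}

/-- The networks with initial value zero and shape parameters `α`, as functions on `[t₀, T]`. -/
noncomputable def trialSpace (t₀ T : ℝ) {N : ℕ} (α : Fin N → ℝ) : Submodule ℝ C(Icc t₀ T, ℝ) :=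
  Submodule.span ℝ (range fun j => trialFunction t₀ T (α j, rbfCenter t₀ T N j))

theorem exists_abs_pirpnn_sub_lt_of_infDist_trialSpace_lt {h : C(Icc t₀ T, ℝ)} {u : ℝ → ℝ} {z : ℝ}
    (hu : ∀ t : Icc t₀ T, h t = u t - z) {α : Fin N → ℝ} {ε : ℝ}
    (hε : Metric.infDist h (trialSpace t₀ T α) < ε) :
    ∃ w : Fin N → ℝ, ∀ t ∈ Icc t₀ T, |pirpnn t₀ T z α w t - u t| < ε := by
  obtain ⟨χ, hχ, hdist⟩ := (Metric.infDist_lt_iff (Submodule.nonempty _)).1 hε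
  obtain ⟨w, rfl⟩ := (Submodule.mem_span_range_iff_exists_fun ℝ).1 hχ
  refine ⟨w, fun t ht => ?_⟩
  have hnetwork : (∑ j, w j • trialFunction t₀ T (α j, rbfCenter t₀ T N j)) ⟨t, ht⟩ =
      pirpnn t₀ T z α w t - z := by
    simp only [ContinuousMap.sum_apply, ContinuousMap.smul_apply, trialFunction, gaussianMap,
      ContinuousMap.mul_apply, ContinuousMap.coe_mk, smul_eq_mul, pirpnn, Finset.mul_sum,
      add_sub_cancel_left]
    exact Finset.sum_congr rfl fun j _ => mul_left_comm _ _ _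
  have hpointwise := (ContinuousMap.dist_apply_le_dist ⟨t, ht⟩).trans_lt hdist
  rwa [hnetwork, hu, dist_comm, dist_sub_right, Real.dist_eq] at hpointwise

theorem exists_finset_forall_infDist_trialSpace_lt (hT : t₀ < T) {h : C(Icc t₀ T, ℝ)}
    (h0 : ∀ t : Icc t₀ T, t.1 = t₀ → h t = 0) {a : ℝ} (ha : a ≠ 0) {ε : ℝ} (hε : 0 < ε) :
    ∃ s : Finset (ℝ × ℝ), ↑s ⊆ {a} ×ˢ Ioo t₀ T ∧ ∃ η > 0, ∀ (N : ℕ) (α : Fin N → ℝ),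
      (∀ x ∈ s, ∃ j, dist x (α j, rbfCenter t₀ T N j) < η) →
      Metric.infDist h (trialSpace t₀ T α) < ε := by
  obtain ⟨s, hs, η, hη, happrox⟩ := exists_finset_forall_subset_thickening_infDist_lt
    (continuous_trialFunction t₀ T)
    (mem_topologicalClosure_span_trialFunction h0 ha isOpen_Ioo (nonempty_Ioo.2 hT)) hε
  refine ⟨s, hs, η, hη, fun N α hα => ?_⟩
  rw [trialSpace, range_comp' (trialFunction t₀ T)]
  exact happrox _ fun x hx => Metric.mem_thickening_iff.2 (exists_range_iff.2 (hα x hx))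

end TrialSpace

section Sampling

theorem exists_nat_forall_lt_mul_mem_Ioc {h x : ℝ} (hh : 0 < h) (hx : 0 ≤ x) (n : ℕ) :
    ∃ k : ℕ, ∀ i < n, ((k + i : ℕ) : ℝ) * h ∈ Ioc x (x + n * h) := by
  refine ⟨⌊x / h⌋₊ + 1, fun i hi => ?_⟩
  have hfloor : ⌊x / h⌋₊ * h ≤ x := (le_div_iff₀ hh).1 (Nat.floor_le (by positivity))
  have hceil : x < (⌊x / h⌋₊ + 1) * h := (div_lt_iff₀ hh).1 (Nat.lt_floor_add_one _)
  have hin : ((i : ℝ) + 1) * h ≤ n * h := by gcongr; exact_mod_cast hi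
  have hi0 : 0 ≤ (i : ℝ) * h := by positivity
  push_cast
  constructor <;> linarith

theorem exists_nat_forall_div_mul_div_sub_one_lt {l r : ℝ} (hl : 0 ≤ l) (hr : 0 < r) :
    ∃ d > 1, ∀ N : ℕ, 2 ≤ N → (N / d : ℕ) * (l / ((N : ℝ) - 1)) < r := by
  obtain ⟨d, hd⟩ := exists_nat_gt (max 1 (2 * l / r))
  obtain ⟨hd1, hdr⟩ := max_lt_iff.1 hd
  refine ⟨d, by exact_mod_cast hd1, fun N hN => ?_⟩
  have hN : (2 : ℝ) ≤ N := by exact_mod_cast hN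
  have hN1 : (0 : ℝ) < N - 1 := by linarith
  calc
    (N / d : ℕ) * (l / ((N : ℝ) - 1)) ≤ N / d * (l / (N - 1)) := by gcongr; exact Nat.cast_div_le
    _ ≤ 2 * (N - 1) / d * (l / (N - 1)) := by gcongr; linarith
    _ = 2 * l / d := by field_simp
    _ < r := (div_lt_comm₀ hr (by linarith)).1 hdr

theorem exists_embedding_forall_dist_rbfCenter_lt {t₀ T c η : ℝ} (hc : c ∈ Ioo t₀ T)
    (hη : 0 < η) :
    ∃ d ≠ 0, ∀ N : ℕ, ∃ e : Fin (N / d) ↪ Fin N, ∀ i, dist c (rbfCenter t₀ T N (e i)) < η := by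
  have hT : 0 < T - t₀ := sub_pos.2 (hc.1.trans hc.2)
  obtain ⟨d, hd, hlength⟩ :=
    exists_nat_forall_div_mul_div_sub_one_lt hT.le (lt_min hη (sub_pos.2 hc.2))
  refine ⟨d, by omega, fun N => ?_⟩
  rcases Nat.lt_or_ge N 2 with hN | hN
  · have : IsEmpty (Fin (N / d)) := by
      rw [Nat.div_eq_of_lt (by omega)]
      infer_instance
    exact ⟨Function.Embedding.ofIsEmpty, isEmptyElim⟩
  have hN1 : (0 : ℝ) < N - 1 := sub_pos.2 (by exact_mod_cast hN)
  obtain ⟨hlengthη, hlengthT⟩ := lt_min_iff.1 (hlength N hN)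
  set h := (T - t₀) / ((N : ℝ) - 1)
  have hh : 0 < h := div_pos hT hN1
  have hNh : (N - 1) * h = T - t₀ := mul_div_cancel₀ _ hN1.ne'
  obtain ⟨k, hk⟩ := exists_nat_forall_lt_mul_mem_Ioc hh (sub_nonneg.2 hc.1.le) (N / d)
  have hlt (i : Fin (N / d)) : k + i < N := by
    have : ((k + i : ℕ) : ℝ) * h < (N - 1) * h := by linarith [(hk i i.2).2]
    exact_mod_cast (lt_of_mul_lt_mul_right this hh.le).trans (sub_one_lt (N : ℝ))
  refine ⟨⟨fun i => ⟨k + i, hlt i⟩, fun i j hij => ?_⟩, fun i => ?_⟩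
  · exact Fin.ext (Nat.add_left_cancel (Fin.mk.inj hij))
  · obtain ⟨hleft, hright⟩ := hk i i.2
    rw [dist_comm, Real.dist_eq]
    change |t₀ + ((k + i : ℕ) : ℝ) * h - c| < η
    exact abs_lt.2 ⟨by linarith, by linarith⟩

theorem tsum_pow_div_ne_top {r : ENNReal} (hr : r < 1) {d : ℕ} (hd : d ≠ 0) :
    ∑' N : ℕ, r ^ (N / d) ≠ ⊤ := by
  have : NeZero d := ⟨hd⟩
  have hsplit : ∑' N : ℕ, r ^ (N / d) = d * (1 - r)⁻¹ := calc
    ∑' N : ℕ, r ^ (N / d) = ∑' x : ℕ × Fin d, r ^ x.1 :=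
      (Nat.divModEquiv d).tsum_eq fun x => r ^ x.1
    _ = ∑' k : ℕ, ∑' _ : Fin d, r ^ k := ENNReal.tsum_prod (f := fun k _ => r ^ k)
    _ = d * (1 - r)⁻¹ := by
      simp [ENNReal.tsum_mul_left, ENNReal.tsum_geometric]
  rw [hsplit]
  exact ENNReal.mul_ne_top (ENNReal.natCast_ne_top d) (ENNReal.inv_ne_top.2 (tsub_pos_of_lt hr).ne')

variable {Ω : Type*} [MeasurableSpace Ω] {P : Measure Ω}

theorem measure_forall_mem_eq_pow_of_hasLaw {κ E : Type*} [Fintype κ] [MeasurableSpace E]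
    {ν : Measure E} {X : κ → Ω → E} (hX : iIndepFun X P) (hlaw : ∀ k, HasLaw (X k) ν P) {A : Set E}
    (hA : MeasurableSet A) : P {ω | ∀ k, X k ω ∈ A} = ν A ^ Fintype.card κ := calc
  P {ω | ∀ k, X k ω ∈ A} = P (⋂ k ∈ Finset.univ, X k ⁻¹' A) := by
    congr 1; ext; simp
  _ = ∏ k, P (X k ⁻¹' A) := hX.measure_inter_preimage_eq_mul _ fun _ _ => hA
  _ = ν A ^ Fintype.card κ :=
    Finset.prod_eq_pow_card fun k _ => (hlaw k).measure_eq hA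

theorem subset_support_cond {X : Type*} [TopologicalSpace X] [MeasurableSpace X]
    [OpensMeasurableSpace X] {μ : Measure X} [μ.IsOpenPosMeasure] {U : Set X} (hU : IsOpen U)
    (hμU : μ U ≠ ⊤) : U ⊆ (ProbabilityTheory.cond μ U).support := fun x hx => by
  refine (Measure.mem_support_iff_forall x).2 fun V hV => ?_
  rw [cond_apply hU.measurableSet]
  exact ENNReal.mul_pos (ENNReal.inv_ne_zero.2 hμU)
    (μ.measure_pos_of_mem_nhds (inter_mem (hU.mem_nhds hx) hV)).ne'

theorem measure_compl_ball_lt_one {E : Type*} [PseudoMetricSpace E] [MeasurableSpace E]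
    [OpensMeasurableSpace E] {ν : Measure E} [IsProbabilityMeasure ν] {x : E}
    (hx : x ∈ ν.support) {η : ℝ} (hη : 0 < η) : ν (Metric.ball x η)ᶜ < 1 := by
  rw [prob_compl_eq_one_sub Metric.isOpen_ball.measurableSet]
  exact ENNReal.sub_lt_self ENNReal.one_ne_top one_ne_zero
    ((Measure.mem_support_iff_forall x).1 hx _ (Metric.ball_mem_nhds x hη)).ne'

variable {ν : Measure ℝ} [IsProbabilityMeasure ν] {t₀ T : ℝ} {X : (N : ℕ) → Fin N → Ω → ℝ}

theorem tsum_measure_forall_le_dist_ne_top (hX : ∀ N, iIndepFun (X N) P)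
    (hlaw : ∀ N j, HasLaw (X N j) ν P) {x : ℝ × ℝ} (hx : x ∈ ν.support ×ˢ Ioo t₀ T) {η : ℝ}
    (hη : 0 < η) : ∑' N, P {ω | ∀ j, η ≤ dist x (X N j ω, rbfCenter t₀ T N j)} ≠ ⊤ := by
  obtain ⟨d, hd, hcenter⟩ := exists_embedding_forall_dist_rbfCenter_lt hx.2 hη
  refine ne_top_of_le_ne_top (tsum_pow_div_ne_top (measure_compl_ball_lt_one hx.1 hη) hd)
    (ENNReal.tsum_le_tsum fun N => ?_)
  obtain ⟨e, he⟩ := hcenter N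
  have hball : MeasurableSet (Metric.ball x.1 η)ᶜ := Metric.isOpen_ball.measurableSet.compl
  have hpow := measure_forall_mem_eq_pow_of_hasLaw (X := fun i => X N (e i))
    ((hX N).precomp e.injective) (fun i => hlaw N (e i)) hball
  rw [Fintype.card_fin] at hpow
  rw [← hpow]
  refine measure_mono fun ω hω i hi => (hω (e i)).not_gt ?_
  exact max_lt (Metric.mem_ball'.1 hi) (he i)

theorem tsum_measure_le_infDist_trialSpace_ne_top (hT : t₀ < T) (hX : ∀ N, iIndepFun (X N) P)
    (hlaw : ∀ N j, HasLaw (X N j) ν P) {a : ℝ} (ha : a ∈ ν.support) (ha0 : a ≠ 0)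
    {h : C(Icc t₀ T, ℝ)} (h0 : ∀ t : Icc t₀ T, t.1 = t₀ → h t = 0) {ε : ℝ} (hε : 0 < ε) :
    ∑' N, P {ω | ε ≤ Metric.infDist h (trialSpace t₀ T fun j => X N j ω)} ≠ ⊤ := by
  obtain ⟨s, hs, η, hη, happrox⟩ := exists_finset_forall_infDist_trialSpace_lt hT h0 ha0 hε
  let missed (x : ℝ × ℝ) (N : ℕ) : Set Ω := {ω | ∀ j, η ≤ dist x (X N j ω, rbfCenter t₀ T N j)}
  have hmissed : ∑' N, ∑ x ∈ s, P (missed x N) ≠ ⊤ := by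
    rw [Summable.tsum_finsetSum fun _ _ => ENNReal.summable]
    refine ENNReal.sum_ne_top.2 fun x hx => tsum_measure_forall_le_dist_ne_top hX hlaw ?_ hη
    exact prod_mono_left (singleton_subset_iff.2 ha) (hs hx)
  refine ne_top_of_le_ne_top hmissed (ENNReal.tsum_le_tsum fun N => ?_)
  refine (measure_mono fun ω hω => ?_).trans (measure_biUnion_finset_le s (missed · N))
  by_contra hhit
  refine (happrox N (fun j => X N j ω) fun x hx => ?_).not_ge hω
  simpa [missed] using fun h => hhit (mem_biUnion hx h)

end Sampling

section Convergence

variable {Ω ι : Type*} [MeasurableSpace Ω] {P : Measure Ω}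

theorem ae_tendsto_zero_of_tsum_measure_le_ne_top {d : ℕ → Ω → ℝ} (hd : ∀ N ω, 0 ≤ d N ω)
    (h : ∀ ε > 0, ∑' N, P {ω | ε ≤ d N ω} ≠ ⊤) :
    ∀ᵐ ω ∂P, Tendsto (fun N => d N ω) atTop (𝓝 0) := by
  have hsmall : ∀ᵐ ω ∂P, ∀ k : ℕ, ∀ᶠ N in atTop, ¬ 1 / ((k : ℝ) + 1) ≤ d N ω :=
    ae_all_iff.2 fun k => ae_eventually_notMem (h _ Nat.one_div_pos_of_nat)
  filter_upwards [hsmall] with ω hω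
  refine (nhds_basis_zero_abs_lt ℝ).tendsto_right_iff.2 fun ε hε => ?_
  obtain ⟨k, hk⟩ := exists_nat_one_div_lt hε
  filter_upwards [hω k] with N hN
  exact (abs_of_nonneg (hd N ω)).trans_lt ((not_le.1 hN).trans hk)

theorem tendsto_measure_exists_zero [Finite ι] {A : ℕ → ι → Ω → Prop}
    (h : ∀ i, Tendsto (fun N => P {ω | A N i ω}) atTop (𝓝 0)) :
    Tendsto (fun N => P {ω | ∃ i, A N i ω}) atTop (𝓝 0) := by
  cases nonempty_fintype ι
  have hsum : Tendsto (fun N => ∑ i, P {ω | A N i ω}) atTop (𝓝 0) := by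
    simpa using tendsto_finsetSum Finset.univ fun i _ => h i
  refine tendsto_of_tendsto_of_tendsto_of_le_of_le tendsto_const_nhds hsum
    (fun _ => zero_le) fun N => ?_
  rw [ofPred_exists]
  exact measure_iUnion_fintype_le P _

variable {t₀ T : ℝ} {α : (N : ℕ) → ι → Fin N → Ω → ℝ} {z : ι → ℝ} {u : ℝ → ι → ℝ}
  {h : ι → C(Icc t₀ T, ℝ)}

theorem pirpnnConverges_of_tsum_measure_infDist_trialSpace_ne_top [Finite ι]
    (hu : ∀ i (t : Icc t₀ T), h i t = u t i - z i)
    (hsum : ∀ i, ∀ ε > 0,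
      ∑' N, P {ω | ε ≤ Metric.infDist (h i) (trialSpace t₀ T fun j => α N i j ω)} ≠ ⊤) :
    PIRPNNConverges P α t₀ T z u := by
  have hgap (N : ℕ) : (0 : ℝ) < 1 / ((N : ℝ) + 1) := Nat.one_div_pos_of_nat
  have hgap0 := tendsto_one_div_add_atTop_nhds_zero_nat (𝕜 := ℝ)
  choose W hW using fun (N : ℕ) (i : ι) (β : Fin N → ℝ) =>
    exists_abs_pirpnn_sub_lt_of_infDist_trialSpace_lt (u := (u · i)) (hu i)
      (lt_add_of_pos_right (Metric.infDist (h i) (trialSpace t₀ T β)) (hgap N))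
  refine ⟨fun N β i => W N i (β i), fun ε hε δ hδ => ?_, ?_⟩
  · have hprob := tendsto_measure_exists_zero fun i =>
      ENNReal.tendsto_atTop_zero_of_tsum_ne_top (hsum i _ (half_pos hε))
    refine eventually_atTop.1 ?_
    filter_upwards [hprob.eventually_le_const (ENNReal.ofReal_pos.2 hδ),
      hgap0.eventually_lt_const (half_pos hε)] with N hN hNε
    refine le_trans (measure_mono ?_) hN
    rintro ω ⟨i, t, ht, hle⟩
    exact ⟨i, by linarith [hW N i (fun j => α N i j ω) t ht]⟩
  · have hdist : ∀ᵐ ω ∂P, ∀ i, Tendsto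
        (fun N => Metric.infDist (h i) (trialSpace t₀ T fun j => α N i j ω)) atTop (𝓝 0) :=
      ae_all_iff.2 fun i =>
        ae_tendsto_zero_of_tsum_measure_le_ne_top (fun _ _ => Metric.infDist_nonneg) (hsum i)
    filter_upwards [hdist] with ω hω i
    have hbound := (hω i).add hgap0
    rw [add_zero] at hbound
    refine Metric.tendstoUniformlyOn_iff.2 fun ε hε => ?_
    filter_upwards [hbound.eventually_lt_const hε] with N hN t ht
    rw [dist_comm, Real.dist_eq]
    exact (hW N i _ t ht).trans hN

theorem pirpnnConverges_of_hasLaw [Finite ι] {ν : Measure ℝ} [IsProbabilityMeasure ν] {a : ℝ}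
    (ha : a ∈ ν.support) (ha0 : a ≠ 0) (hα : ∀ N i, iIndepFun (α N i) P)
    (hlaw : ∀ N i j, HasLaw (α N i j) ν P) (hT : t₀ < T) (hu : ContinuousOn u (Icc t₀ T))
    (hz : u t₀ = z) : PIRPNNConverges P α t₀ T z u := by
  have hcont := continuousOn_iff_continuous_domRestrict.1 hu
  let h (i : ι) : C(Icc t₀ T, ℝ) :=
    ⟨fun t => u t i - z i, ((continuous_apply i).comp hcont).sub continuous_const⟩
  refine pirpnnConverges_of_tsum_measure_infDist_trialSpace_ne_top (h := h) (fun _ _ => rfl)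
    fun i ε hε => tsum_measure_le_infDist_trialSpace_ne_top hT (fun N => hα N i)
      (fun N => hlaw N i) ha ha0 (fun t ht => ?_) hε
  change u t i - z i = 0
  rw [ht, hz, sub_self]

theorem pirpnnConverges_of_isIIDUniform [Finite ι] {a b : ℝ} (hab : a < b)
    (hα : ∀ N, IsIIDUniform P a b (fun k : ι × Fin N => α N k.1 k.2)) (hT : t₀ < T)
    (hu : ContinuousOn u (Icc t₀ T)) (hz : u t₀ = z) : PIRPNNConverges P α t₀ T z u := by
  have hpos : volume (Ioo a b) ≠ 0 := by simpa using hab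
  have hfin : volume (Ioo a b) ≠ ⊤ := measure_Ioo_lt_top.ne
  have : IsProbabilityMeasure (ProbabilityTheory.cond (volume : Measure ℝ) (Ioo a b)) :=
    cond_isProbabilityMeasure_of_finite hpos hfin
  have hindep (N : ℕ) (i : ι) : iIndepFun (fun j => α N i j) P :=
    (hα N).2.1.precomp (g := Prod.mk i) (Prod.mk_right_injective i)
  obtain ⟨x, hx, hx0⟩ := (Ioo_infinite hab).exists_notMem_finset {0}
  exact pirpnnConverges_of_hasLaw (subset_support_cond isOpen_Ioo hfin hx)
    (Finset.notMem_singleton.1 hx0) hindep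
    (fun N i j => ⟨((hα N).1 (i, j)).aemeasurable, (hα N).2.2 (i, j)⟩) hT hu hz

end Convergence

theorem continuousOn_sumElim {X ι κ M : Type*} [TopologicalSpace X] [TopologicalSpace M]
    {u : X → ι → M} {v : X → κ → M} {s : Set X} (hu : ContinuousOn u s) (hv : ContinuousOn v s) :
    ContinuousOn (fun t => Sum.elim (u t) (v t)) s :=
  continuousOn_pi.2 (Sum.rec (continuousOn_pi.1 hu) (continuousOn_pi.1 hv))

theorem proposition1_general {Ω : Type*} [MeasurableSpace Ω] (P : Measure Ω) (a b : ℝ)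
    (hab : a < b) (t₀ : ℝ) :
    (∀ (m : ℕ) (f : ℝ → (Fin m → ℝ) → (Fin m → ℝ)) (D : Set (ℝ × (Fin m → ℝ))) (z : Fin m → ℝ),
      ContinuousOn (fun x : ℝ × (Fin m → ℝ) => f x.1 x.2) D →
      (∃ K, ∀ t, LipschitzOnWith K (f t) {x | (t, x) ∈ D}) →
      (D ∈ 𝓝[Ici t₀ ×ˢ univ] (t₀, z) → ∃ T > t₀, ∃ u, IsODESolution f D t₀ T z u) ∧
      ∀ T > t₀, ∀ u, IsODESolution f D t₀ T z u →
        (∀ u', IsODESolution f D t₀ T z u' → EqOn u' u (Icc t₀ T)) ∧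
        ContDiffOn ℝ 1 u (Icc t₀ T) ∧
        ∀ α : (N : ℕ) → Fin m → Fin N → Ω → ℝ,
          (∀ N, IsIIDUniform P a b (fun k : Fin m × Fin N => α N k.1 k.2)) →
          PIRPNNConverges P α t₀ T z u) ∧
    (∀ (p q : ℕ) (f : ℝ → (Fin p → ℝ) → (Fin q → ℝ) → (Fin p → ℝ))
      (g : ℝ → (Fin p → ℝ) → (Fin q → ℝ) → (Fin q → ℝ))
      (D : Set (ℝ × (Fin p → ℝ) × (Fin q → ℝ))) (z : Fin p → ℝ) (y : Fin q → ℝ),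
      ContinuousOn (fun x : ℝ × (Fin p → ℝ) × (Fin q → ℝ) => f x.1 x.2.1 x.2.2) D →
      (∃ K, ∀ t, LipschitzOnWith K (fun x : (Fin p → ℝ) × (Fin q → ℝ) => f t x.1 x.2)
        {x | (t, x) ∈ D}) →
      (∀ x ∈ D, ContDiffAt ℝ 1
        (fun x : ℝ × (Fin p → ℝ) × (Fin q → ℝ) => g x.1 x.2.1 x.2.2) x) →
      (∀ x ∈ D, g x.1 x.2.1 x.2.2 = 0 → (fderiv ℝ (g x.1 x.2.1) x.2.2).det ≠ 0) →
      (D ∈ 𝓝[Ici t₀ ×ˢ univ] (t₀, z, y) → g t₀ z y = 0 →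
        ∃ T > t₀, ∃ u v, IsDAESolution f g D t₀ T z y u v) ∧
      ∀ T > t₀, ∀ u v, IsDAESolution f g D t₀ T z y u v →
        (∀ u' v', IsDAESolution f g D t₀ T z y u' v' →
          EqOn u' u (Icc t₀ T) ∧ EqOn v' v (Icc t₀ T)) ∧
        ContDiffOn ℝ 1 u (Icc t₀ T) ∧
        ∀ α : (N : ℕ) → Fin p ⊕ Fin q → Fin N → Ω → ℝ,
          (∀ N, IsIIDUniform P a b (fun k : (Fin p ⊕ Fin q) × Fin N => α N k.1 k.2)) →
          PIRPNNConverges P α t₀ T (Sum.elim z y) (fun t => Sum.elim (u t) (v t))) := by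
  simp only [isODESolution_iff_isIVPSolution, isDAESolution_iff_isSemiexplicitSolution,
    nhdsWithin_prod_eq, nhdsWithin_univ]
  refine ⟨fun m f D z hc ⟨K, hl⟩ => ⟨exists_isIVPSolution hc hl, fun T hT u hu => ⟨?_, ?_, ?_⟩⟩,
    fun p q f g D z y hc ⟨K, hl⟩ hg hdet => ?_⟩
  · exact fun u' hu' => hu'.eqOn hl hu
  · exact hu.contDiffOn hT (hc.comp hu.continuousOn_graph hu.mem)
  · exact fun α hα => pirpnnConverges_of_isIIDUniform hab hα hT hu.continuousOn hu.initial
  have hindex : IsIndexOne g D := isIndexOne_of_det_ne_zero hg hdet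
  refine ⟨exists_isSemiexplicitSolution hc hl hindex, fun T hT u v h => ⟨?_, ?_, ?_⟩⟩
  · intro u' v' h'
    have heq := h'.eqOn_prodMk hl hindex h
    exact ⟨fun t ht => congrArg Prod.fst (heq ht), fun t ht => congrArg Prod.snd (heq ht)⟩
  · exact h.contDiffOn_differential hT hc
  · refine fun α hα => pirpnnConverges_of_isIIDUniform hab hα hT ?_ ?_
    · exact continuousOn_sumElim h.continuousOn h.continuousOn_algebraic
    · rw [h.initial, h.initial_algebraic]

theorem proposition1 {Ω : Type*} [MeasurableSpace Ω] (P : Measure Ω) [IsProbabilityMeasure P]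
    (a b : ℝ) (ha : 0 ≤ a) (hab : a < b) (t₀ : ℝ) :
    -- ODEs in canonical form
    (∀ (m : ℕ) (f : ℝ → (Fin m → ℝ) → (Fin m → ℝ)) (D : Set (ℝ × (Fin m → ℝ))) (z : Fin m → ℝ),
      ContinuousOn (fun x : ℝ × (Fin m → ℝ) => f x.1 x.2) D →
      (∃ K, ∀ t, LipschitzOnWith K (f t) {x | (t, x) ∈ D}) →
      (D ∈ 𝓝[Ici t₀ ×ˢ univ] (t₀, z) → ∃ T > t₀, ∃ u, IsODESolution f D t₀ T z u) ∧
      ∀ T > t₀, ∀ u, IsODESolution f D t₀ T z u →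
        (∀ u', IsODESolution f D t₀ T z u' → EqOn u' u (Icc t₀ T)) ∧
        ContDiffOn ℝ 1 u (Icc t₀ T) ∧
        ∀ α : (N : ℕ) → Fin m → Fin N → Ω → ℝ,
          (∀ N, IsIIDUniform P a b (fun k : Fin m × Fin N => α N k.1 k.2)) →
          PIRPNNConverges P α t₀ T z u) ∧
    -- index-1 DAEs in semiexplicit form
    (∀ (p q : ℕ) (f : ℝ → (Fin p → ℝ) → (Fin q → ℝ) → (Fin p → ℝ))
      (g : ℝ → (Fin p → ℝ) → (Fin q → ℝ) → (Fin q → ℝ))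
      (D : Set (ℝ × (Fin p → ℝ) × (Fin q → ℝ))) (z : Fin p → ℝ) (y : Fin q → ℝ),
      ContinuousOn (fun x : ℝ × (Fin p → ℝ) × (Fin q → ℝ) => f x.1 x.2.1 x.2.2) D →
      (∃ K, ∀ t, LipschitzOnWith K (fun x : (Fin p → ℝ) × (Fin q → ℝ) => f t x.1 x.2)
        {x | (t, x) ∈ D}) →
      (∀ x ∈ D, ContDiffAt ℝ 1
        (fun x : ℝ × (Fin p → ℝ) × (Fin q → ℝ) => g x.1 x.2.1 x.2.2) x) →
      (∀ x ∈ D, g x.1 x.2.1 x.2.2 = 0 → (fderiv ℝ (g x.1 x.2.1) x.2.2).det ≠ 0) →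
      (D ∈ 𝓝[Ici t₀ ×ˢ univ] (t₀, z, y) → g t₀ z y = 0 →
        ∃ T > t₀, ∃ u v, IsDAESolution f g D t₀ T z y u v) ∧
      ∀ T > t₀, ∀ u v, IsDAESolution f g D t₀ T z y u v →
        (∀ u' v', IsDAESolution f g D t₀ T z y u' v' →
          EqOn u' u (Icc t₀ T) ∧ EqOn v' v (Icc t₀ T)) ∧
        ContDiffOn ℝ 1 u (Icc t₀ T) ∧
        ∀ α : (N : ℕ) → Fin p ⊕ Fin q → Fin N → Ω → ℝ,
          (∀ N, IsIIDUniform P a b (fun k : (Fin p ⊕ Fin q) × Fin N => α N k.1 k.2)) →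
          PIRPNNConverges P α t₀ T (Sum.elim z y) (fun t => Sum.elim (u t) (v t))) :=
  proposition1_general P a b hab t₀
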